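/- Let $G$ be a connected (finite, simple) graph of order $n\ge 4$ and size $m$ with clique number $\omega\ge 2$, and let $K_\omega$ be a clique of $G$ on $\omega$ vertices. Let $H=G\setminus K_\omega$ be the graph obtained from $G$ by removing the edges of $K_\omega$ (keeping all vertices), and let $r$ be the number of non-trivial components of $H$, i.e. components with at least two vertices. Suppose that, for some integer $c\ge 0$, each of these $r$ components is a $c$-cyclic graph, i.e. a connected graph with $N$ vertices and $N+c-1$ edges for some $N$. Let $\mu_1\ge\mu_2\ge\dots\ge\mu_n=0$ be the eigenvalues (with multiplicity) of the Laplacian matrix $L(G)=D(G)-A(G)$, and put $S_k(G)=\sum_{i=1}^{k}\mu_i$. Set $$\gamma_1=\frac{2\omega+3-\sqrt{16\omega+8r(c-1)+9}}{2},\qquad \beta_1=\frac{3+\sqrt{4\omega^2-4\omega+8r(c-1)+9}}{2}.$$ Then $$S_k(G)\le m+\frac{k(k+1)}{2}$$ for all integers $k\in[1,\min\{\omega-2,\gamma_1\}]$ and for all integers $k\in[\beta_1,n]$. -/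

import Mathlib

namespace Brouwer

/-- The sum `S_k(G)` of the `k` largest eigenvalues `μ₁ ≥ μ₂ ≥ ⋯ ≥ μ_n` of the Laplacian matrix
`L(G) = D(G) - A(G)`, counted with multiplicity; Mathlib's `eigenvalues₀` lists them in
decreasing order, indexed from `0`. -/
noncomputable def laplacianSum {V : Type*} [Fintype V] [DecidableEq V]
    (G : SimpleGraph V) [DecidableRel G.Adj] (k : ℕ) : ℝ :=
  ∑ i : Fin (Fintype.card V) with i.val < k, (G.isHermitian_lapMatrix ℝ).eigenvalues₀ i

/-- The graph obtained from `G` by removing the edges joining two vertices of `K`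
(all vertices of `G` are kept). -/
def removeEdgesWithin {V : Type*} (G : SimpleGraph V) (K : Finset V) : SimpleGraph V :=
  G.deleteEdges {e | ∀ v ∈ e, v ∈ K}

/-- A `c`-cyclic graph: a (finite) connected graph with `N` vertices and `N + c - 1` edges. -/
def IsCyclicOfRank {W : Type*} (c : ℕ) (H : SimpleGraph W) : Prop :=
  H.Connected ∧ H.edgeSet.ncard + 1 = Nat.card W + c

/-- The set of non-trivial components of `H`, i.e. those with at least two vertices. -/
def nontrivialComponents {V : Type*} (H : SimpleGraph V) : Set H.ConnectedComponent :=
  {C | C.supp.Nontrivial}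

end Brouwer

namespace Brouwer

open Finset Matrix

variable {V : Type*} [Fintype V] [DecidableEq V]

theorem dotProduct_lapMatrix_mulVec (G : SimpleGraph V) [DecidableRel G.Adj] (x : V → ℝ) :
    x ⬝ᵥ (G.lapMatrix ℝ *ᵥ x) = (∑ i, ∑ j, if G.Adj i j then (x i - x j) ^ 2 else 0) / 2 := by
  rw [← G.lapMatrix_toLinearMap₂' ℝ x, Matrix.toLinearMap₂'_apply']

theorem dotProduct_lapMatrix_mulVec_nonneg (G : SimpleGraph V) [DecidableRel G.Adj] (x : V → ℝ) :
    0 ≤ x ⬝ᵥ (G.lapMatrix ℝ *ᵥ x) := by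
  rw [dotProduct_lapMatrix_mulVec]
  exact div_nonneg (sum_nonneg fun i _ => sum_nonneg fun j _ => by split_ifs <;> positivity)
    zero_le_two

/-- The normalized Laplacian is bounded by `2`, in the form `L D⁻¹ L ≤ 2 L`. -/
theorem sum_lapMatrix_mulVec_sq_div_degree_le (G : SimpleGraph V) [DecidableRel G.Adj]
    (x : V → ℝ) :
    ∑ v, (G.lapMatrix ℝ *ᵥ x) v ^ 2 / G.degree v ≤ 2 * (x ⬝ᵥ (G.lapMatrix ℝ *ᵥ x)) := by
  rw [dotProduct_lapMatrix_mulVec, mul_div_cancel₀ _ two_ne_zero]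
  refine sum_le_sum fun v _ => ?_
  have h1 : (G.lapMatrix ℝ *ᵥ x) v = ∑ u ∈ G.neighborFinset v, (x v - x u) := by
    rw [SimpleGraph.lapMatrix_mulVec_apply, sum_sub_distrib, sum_const, nsmul_eq_mul,
      G.card_neighborFinset_eq_degree]
  have h2 : (∑ j, if G.Adj v j then (x v - x j) ^ 2 else 0)
      = ∑ u ∈ G.neighborFinset v, (x v - x u) ^ 2 := by
    rw [← sum_filter, SimpleGraph.neighborFinset_eq_filter]
  rw [h1, h2, ← G.card_neighborFinset_eq_degree]
  refine div_le_of_le_mul₀ (Nat.cast_nonneg _) (sum_nonneg fun _ _ => sq_nonneg _) ?_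
  rw [mul_comm]
  exact sq_sum_le_card_mul_sum_sq

theorem dotProduct_mulVec_eq_sum_eigenvalues {A : Matrix V V ℝ} (hA : A.IsHermitian)
    (v : EuclideanSpace ℝ V) :
    v ⬝ᵥ (A *ᵥ v) = ∑ j, hA.eigenvalues j * inner ℝ (hA.eigenvectorBasis j) v ^ 2 := by
  have h0 : v ⬝ᵥ (A *ᵥ v) = inner ℝ v (WithLp.toLp 2 (A *ᵥ v)) := by
    simp [PiLp.inner_apply, dotProduct, mul_comm]
  rw [h0, ← hA.eigenvectorBasis.sum_inner_mul_inner]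
  refine sum_congr rfl fun j _ => ?_
  have h1 : inner ℝ (hA.eigenvectorBasis j) (WithLp.toLp 2 (A *ᵥ v))
      = hA.eigenvalues j * inner ℝ (hA.eigenvectorBasis j) v := by
    have h2 : inner ℝ (hA.eigenvectorBasis j) (WithLp.toLp 2 (A *ᵥ v))
        = (hA.eigenvectorBasis j) ⬝ᵥ (A *ᵥ v) := by
      simp [PiLp.inner_apply, dotProduct, mul_comm]
    have h3 : Aᵀ = A := by simpa [conjTranspose_eq_transpose_of_trivial] using hA.eq
    rw [h2, dotProduct_mulVec, ← mulVec_transpose, h3, hA.mulVec_eigenvectorBasis,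
      smul_dotProduct, smul_eq_mul]
    simp [PiLp.inner_apply, dotProduct, mul_comm]
  rw [h1, real_inner_comm]
  ring

theorem sum_eigenvalues_mul_sq {A : Matrix V V ℝ} (hA : A.IsHermitian) (x : V) :
    ∑ j, hA.eigenvalues j * hA.eigenvectorBasis j x ^ 2 = A x x := by
  have h := dotProduct_mulVec_eq_sum_eigenvalues hA (EuclideanSpace.single x 1)
  simpa [EuclideanSpace.inner_single_right] using h.symm

theorem sum_sq_apply {V : Type*} [Fintype V] (v : EuclideanSpace ℝ V) : ∑ x, v x ^ 2 = ‖v‖ ^ 2 := by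
  simp [EuclideanSpace.norm_sq_eq]

theorem dotProduct_eigenvectorBasis_mulVec {A : Matrix V V ℝ} (hA : A.IsHermitian) (j : V) :
    hA.eigenvectorBasis j ⬝ᵥ (A *ᵥ hA.eigenvectorBasis j) = hA.eigenvalues j := by
  rw [hA.mulVec_eigenvectorBasis, dotProduct_smul, smul_eq_mul]
  have := sum_sq_apply (hA.eigenvectorBasis j)
  simp only [OrthonormalBasis.norm_eq_one, one_pow] at this
  simp [dotProduct, ← sq, this]

theorem laplacian_eigenvalue_nonneg (G : SimpleGraph V) [DecidableRel G.Adj] (j : V) :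
    0 ≤ (G.isHermitian_lapMatrix ℝ).eigenvalues j := by
  rw [← dotProduct_eigenvectorBasis_mulVec]
  exact dotProduct_lapMatrix_mulVec_nonneg _ _

theorem laplacian_eigenvalue_le (G : SimpleGraph V) [DecidableRel G.Adj] (j : V) :
    (G.isHermitian_lapMatrix ℝ).eigenvalues j ≤ 2 +
      ∑ x, (G.isHermitian_lapMatrix ℝ).eigenvalues j *
        (G.isHermitian_lapMatrix ℝ).eigenvectorBasis j x ^ 2 * (1 - (G.degree x : ℝ)⁻¹) := by
  have h1 := sum_lapMatrix_mulVec_sq_div_degree_le G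
    ((G.isHermitian_lapMatrix ℝ).eigenvectorBasis j)
  have h2 := sum_sq_apply ((G.isHermitian_lapMatrix ℝ).eigenvectorBasis j)
  rw [dotProduct_eigenvectorBasis_mulVec, Matrix.IsHermitian.mulVec_eigenvectorBasis] at h1
  rw [OrthonormalBasis.norm_eq_one, one_pow] at h2
  set μ := (G.isHermitian_lapMatrix ℝ).eigenvalues j with hμ
  have hμ0 : 0 ≤ μ := laplacian_eigenvalue_nonneg G j
  set u := (G.isHermitian_lapMatrix ℝ).eigenvectorBasis j
  have h3 : ∑ x, μ * u x ^ 2 * (1 - (G.degree x : ℝ)⁻¹)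
      = μ - μ * ∑ x, u x ^ 2 * (G.degree x : ℝ)⁻¹ := by
    simp_rw [mul_sub, mul_one, sum_sub_distrib]
    rw [← mul_sum, h2, mul_one, mul_sum]
    simp_rw [mul_assoc]
  rw [h3]
  have h4 : μ * (μ * ∑ x, u x ^ 2 * (G.degree x : ℝ)⁻¹) ≤ μ * 2 := by
    rw [mul_comm μ 2]
    refine le_trans (le_of_eq ?_) h1
    rw [mul_sum, mul_sum]
    refine sum_congr rfl fun x _ => ?_
    simp only [Pi.smul_apply, smul_eq_mul]
    ring
  rcases hμ0.eq_or_lt with h | h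
  · rw [← h]; norm_num
  · linarith [le_of_mul_le_mul_left h4 h]

theorem sum_lapMatrix_form_le (G : SimpleGraph V) [DecidableRel G.Adj]
    (b : OrthonormalBasis V ℝ (EuclideanSpace ℝ V)) (S : Finset V) :
    ∑ i ∈ S, b i ⬝ᵥ (G.lapMatrix ℝ *ᵥ b i) ≤ 2 * #S + ∑ x, ((G.degree x - 1 : ℕ) : ℝ) := by
  set hA := G.isHermitian_lapMatrix ℝ
  have hp (j : V) : ∑ i ∈ S, inner ℝ (hA.eigenvectorBasis j) (b i) ^ 2 ≤ 1 := by
    have h := b.sum_sq_inner_left (hA.eigenvectorBasis j)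
    rw [OrthonormalBasis.norm_eq_one, one_pow] at h
    rw [← h]
    exact sum_le_sum_of_subset_of_nonneg (subset_univ _) fun _ _ _ => sq_nonneg _
  have hq (j x : V) : 0 ≤ hA.eigenvalues j * hA.eigenvectorBasis j x ^ 2 *
      (1 - (G.degree x : ℝ)⁻¹) := by
    refine mul_nonneg (mul_nonneg (laplacian_eigenvalue_nonneg G j) (sq_nonneg _)) ?_
    exact sub_nonneg.2 (Nat.cast_inv_le_one _)
  calc ∑ i ∈ S, b i ⬝ᵥ (G.lapMatrix ℝ *ᵥ b i)
      = ∑ j, hA.eigenvalues j * ∑ i ∈ S, inner ℝ (hA.eigenvectorBasis j) (b i) ^ 2 := by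
        simp_rw [dotProduct_mulVec_eq_sum_eigenvalues hA, mul_sum]
        exact sum_comm
    _ ≤ ∑ j, (2 * ∑ i ∈ S, inner ℝ (hA.eigenvectorBasis j) (b i) ^ 2 +
          ∑ x, hA.eigenvalues j * hA.eigenvectorBasis j x ^ 2 * (1 - (G.degree x : ℝ)⁻¹)) := by
        refine sum_le_sum fun j _ => ?_
        have h0 : 0 ≤ ∑ i ∈ S, inner ℝ (hA.eigenvectorBasis j) (b i) ^ 2 :=
          sum_nonneg fun _ _ => sq_nonneg _
        have h1 := mul_le_mul_of_nonneg_right (laplacian_eigenvalue_le G j) h0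
        have h2 := mul_le_of_le_one_right (sum_nonneg fun x (_ : x ∈ univ) => hq j x) (hp j)
        rw [add_mul] at h1
        linarith
    _ = 2 * #S + ∑ x, ((G.degree x - 1 : ℕ) : ℝ) := by
        rw [sum_add_distrib, ← mul_sum, sum_comm, sum_comm (s := univ) (t := univ)]
        congr 1
        · congr 1
          rw [card_eq_sum_ones, Nat.cast_sum]
          refine sum_congr rfl fun i _ => ?_
          rw [hA.eigenvectorBasis.sum_sq_inner_right, OrthonormalBasis.norm_eq_one]
          norm_num
        · refine sum_congr rfl fun x _ => ?_
          rw [← sum_mul, sum_eigenvalues_mul_sq hA]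
          have hd : G.lapMatrix ℝ x x = G.degree x := by
            simp [SimpleGraph.lapMatrix, SimpleGraph.degMatrix]
          rw [hd]
          rcases Nat.eq_zero_or_pos (G.degree x) with h | h
          · simp [h]
          · rw [Nat.cast_pred h, mul_sub, mul_one, mul_inv_cancel₀ (by positivity)]

theorem exists_laplacianSum_eq (G : SimpleGraph V) [DecidableRel G.Adj] (k : ℕ) :
    ∃ S : Finset V, #S ≤ k ∧ laplacianSum G k =
      ∑ i ∈ S, (G.isHermitian_lapMatrix ℝ).eigenvectorBasis i ⬝ᵥ
        (G.lapMatrix ℝ *ᵥ (G.isHermitian_lapMatrix ℝ).eigenvectorBasis i) := by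
  let e : Fin (Fintype.card V) ≃ V := Fintype.equivOfCardEq (Fintype.card_fin _)
  refine ⟨(univ.filter fun i : Fin (Fintype.card V) => i.val < k).map e.toEmbedding, ?_, ?_⟩
  · rw [card_map, ← card_map Fin.valEmbedding]
    refine (card_le_card (t := range k) fun i hi => ?_).trans_eq (card_range k)
    simp only [mem_map, mem_filter] at hi
    obtain ⟨a, ha, rfl⟩ := hi
    exact mem_range.2 ha.2
  · rw [sum_map, laplacianSum]
    refine sum_congr rfl fun i _ => ?_
    rw [dotProduct_eigenvectorBasis_mulVec, Matrix.IsHermitian.eigenvalues]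
    congr 1
    exact (e.symm_apply_apply i).symm

theorem removeEdgesWithin_adj {V : Type*} (G : SimpleGraph V) (K : Finset V) (u v : V) :
    (removeEdgesWithin G K).Adj u v ↔ G.Adj u v ∧ ¬(u ∈ K ∧ v ∈ K) := by
  simp [removeEdgesWithin, SimpleGraph.deleteEdges_adj]

theorem sum_ite_adj_eq_of_isClique (G : SimpleGraph V) [DecidableRel G.Adj] {K : Finset V}
    [DecidableRel (removeEdgesWithin G K).Adj] (hK : G.IsClique K) (f : V → V → ℝ)
    (hf : ∀ v, f v v = 0) :
    (∑ i, ∑ j, if G.Adj i j then f i j else 0) =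
      (∑ i, ∑ j, if (removeEdgesWithin G K).Adj i j then f i j else 0) +
        ∑ i ∈ K, ∑ j ∈ K, f i j := by
  have h : ∑ i ∈ K, ∑ j ∈ K, f i j = ∑ i, ∑ j, if i ∈ K ∧ j ∈ K then f i j else 0 := by
    simp [ite_and, sum_ite_mem]
  rw [h, ← sum_add_distrib]
  refine sum_congr rfl fun i _ => ?_
  rw [← sum_add_distrib]
  refine sum_congr rfl fun j _ => ?_
  simp only [removeEdgesWithin_adj]
  by_cases h1 : i ∈ K ∧ j ∈ K
  · by_cases h2 : i = j
    · subst h2; simp [hf]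
    · simp [h1, hK h1.1 h1.2 h2]
  · simp [h1]

theorem lapMatrix_form_eq_add (G : SimpleGraph V) [DecidableRel G.Adj] {K : Finset V}
    [DecidableRel (removeEdgesWithin G K).Adj] (hK : G.IsClique K) (x : V → ℝ) :
    x ⬝ᵥ (G.lapMatrix ℝ *ᵥ x) = x ⬝ᵥ ((removeEdgesWithin G K).lapMatrix ℝ *ᵥ x) +
      (∑ i ∈ K, ∑ j ∈ K, (x i - x j) ^ 2) / 2 := by
  rw [dotProduct_lapMatrix_mulVec, dotProduct_lapMatrix_mulVec,
    sum_ite_adj_eq_of_isClique G hK _ (by simp), add_div]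

theorem sum_degree_eq_add (G : SimpleGraph V) [DecidableRel G.Adj] {K : Finset V}
    [DecidableRel (removeEdgesWithin G K).Adj] (hK : G.IsClique K) :
    (∑ x, (G.degree x : ℝ)) = (∑ x, ((removeEdgesWithin G K).degree x : ℝ)) + #K * (#K - 1) := by
  have h := sum_ite_adj_eq_of_isClique G hK (fun i j => if i = j then 0 else 1) (by simp)
  have e (H : SimpleGraph V) [DecidableRel H.Adj] : (∑ x, (H.degree x : ℝ)) =
      ∑ i, ∑ j, if H.Adj i j then (if i = j then 0 else 1) else 0 := by
    refine sum_congr rfl fun i _ => ?_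
    rw [H.degree_eq_sum_if_adj]
    refine sum_congr rfl fun j _ => ?_
    split_ifs with h1 h2
    · exact absurd h2 h1.ne
    all_goals rfl
  rw [e, e, h]
  congr 1
  rw [← nsmul_eq_mul, ← sum_const]
  refine sum_congr rfl fun i hi => ?_
  rw [← add_sum_erase _ _ hi, if_pos rfl, zero_add,
    sum_congr rfl fun j hj => if_neg (ne_of_mem_erase hj).symm]
  rw [sum_const, card_erase_of_mem hi, nsmul_one, Nat.cast_pred (card_pos.2 ⟨i, hi⟩)]

theorem sum_sum_sub_sq_div_two_le {V : Type*} [Fintype V] (K : Finset V) (x : V → ℝ) :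
    (∑ i ∈ K, ∑ j ∈ K, (x i - x j) ^ 2) / 2 ≤ #K * ∑ v, x v ^ 2 := by
  have h : ∑ i ∈ K, ∑ j ∈ K, (x i - x j) ^ 2
      = 2 * (#K * ∑ i ∈ K, x i ^ 2) - 2 * (∑ i ∈ K, x i) ^ 2 := by
    simp_rw [sub_sq, sum_add_distrib, sum_sub_distrib, sum_const, ← mul_sum, mul_assoc, ← mul_sum,
      ← sum_mul, nsmul_eq_mul, ← mul_sum]
    ring
  have h2 : #K * ∑ i ∈ K, x i ^ 2 ≤ #K * ∑ v, x v ^ 2 :=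
    mul_le_mul_of_nonneg_left
      (sum_le_sum_of_subset_of_nonneg (subset_univ _) fun _ _ _ => sq_nonneg _) (Nat.cast_nonneg _)
  rw [h]
  linarith [sq_nonneg (∑ i ∈ K, x i)]

theorem sum_clique_form_le_card_mul {V : Type*} [Fintype V] (K S : Finset V)
    (b : OrthonormalBasis V ℝ (EuclideanSpace ℝ V)) :
    ∑ l ∈ S, (∑ i ∈ K, ∑ j ∈ K, (b l i - b l j) ^ 2) / 2 ≤ #K * #S := by
  rw [mul_comm, ← nsmul_eq_mul, ← sum_const]
  refine sum_le_sum fun l _ => (sum_sum_sub_sq_div_two_le K (b l)).trans_eq ?_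
  rw [sum_sq_apply, OrthonormalBasis.norm_eq_one, one_pow, mul_one]

theorem sum_clique_form_le_trace (K S : Finset V)
    (b : OrthonormalBasis V ℝ (EuclideanSpace ℝ V)) :
    ∑ l ∈ S, (∑ i ∈ K, ∑ j ∈ K, (b l i - b l j) ^ 2) / 2 ≤ #K * (#K - 1) := by
  have h (i j : V) (hij : j ≠ i) : ∑ l ∈ S, (b l i - b l j) ^ 2 ≤ 2 := by
    have h1 := b.sum_sq_inner_left (EuclideanSpace.single i (1 : ℝ) - EuclideanSpace.single j 1)
    have h2 : ‖(EuclideanSpace.single i (1 : ℝ) - EuclideanSpace.single j 1 :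
        EuclideanSpace ℝ V)‖ ^ 2 = 2 := by
      rw [norm_sub_sq_real]
      simp [EuclideanSpace.inner_single_left, hij.symm]
      norm_num
    rw [h2] at h1
    rw [← h1]
    refine (sum_le_sum_of_subset_of_nonneg (subset_univ S) fun _ _ _ => sq_nonneg _).trans_eq ?_
    refine sum_congr rfl fun l _ => ?_
    simp [inner_sub_left, EuclideanSpace.inner_single_left]
  rw [← sum_div, sum_comm, div_le_iff₀ two_pos, mul_assoc, ← nsmul_eq_mul, ← sum_const]
  refine sum_le_sum fun i hi => ?_
  rw [sum_comm, ← add_sum_erase _ _ hi]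
  simp only [sub_self, ne_eq, OfNat.ofNat_ne_zero, not_false_eq_true, zero_pow, sum_const_zero,
    zero_add]
  refine (sum_le_card_nsmul _ _ 2 fun j hj => h i j (ne_of_mem_erase hj)).trans_eq ?_
  rw [card_erase_of_mem hi, nsmul_eq_mul, Nat.cast_pred (card_pos.2 ⟨i, hi⟩)]

theorem degree_toSimpleGraph {V : Type*} {H : SimpleGraph V} (C : H.ConnectedComponent) (x : C)
    [Fintype (C.toSimpleGraph.neighborSet x)] [Fintype (H.neighborSet x)] :
    C.toSimpleGraph.degree x = H.degree x := by
  have h : H.neighborSet x ⊆ C.supp := fun y hy =>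
    (SimpleGraph.ConnectedComponent.mem_supp_congr_adj C hy).1 x.2
  rw [← SimpleGraph.card_neighborSet_eq_degree, ← SimpleGraph.card_neighborSet_eq_degree]
  exact Fintype.card_congr
    { toFun := fun y => ⟨y.1, y.2⟩
      invFun := fun y => ⟨⟨y.1, h y.2⟩, y.2⟩
      left_inv := fun _ => rfl
      right_inv := fun _ => rfl }

open Classical in
theorem sum_degree_sub_one_component {V : Type*} [Fintype V] {H : SimpleGraph V} [DecidableRel H.Adj] {c : ℕ}
    (hc : ∀ C ∈ nontrivialComponents H, IsCyclicOfRank c C.toSimpleGraph)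
    (C : H.ConnectedComponent) :
    ∑ x : C, ((H.degree x - 1 : ℕ) : ℝ) =
      (∑ x : C, (H.degree x : ℝ)) / 2 + if C ∈ nontrivialComponents H then (c : ℝ) - 1 else 0 := by
  by_cases hC : C ∈ nontrivialComponents H
  · have : Nontrivial C := Set.nontrivial_coe_sort.2 hC
    obtain ⟨h1, h2⟩ := hc C hC
    have hd (x : C) : ((H.degree x - 1 : ℕ) : ℝ) = H.degree x - 1 := by
      rw [Nat.cast_pred]
      rw [← degree_toSimpleGraph C x]
      exact h1.preconnected.degree_pos_of_nontrivial x
    have h3 : ∑ x : C, (H.degree x : ℝ) = 2 * (C.toSimpleGraph.edgeSet.ncard : ℝ) := by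
      rw [← SimpleGraph.coe_edgeFinset, Set.ncard_coe_finset]
      have := C.toSimpleGraph.sum_degrees_eq_twice_card_edges
      simp_rw [degree_toSimpleGraph C] at this
      exact_mod_cast this
    have h4 : (C.toSimpleGraph.edgeSet.ncard : ℝ) + 1 = Fintype.card C + c := by
      rw [← Nat.card_eq_fintype_card]
      exact_mod_cast h2
    simp_rw [hd, sum_sub_distrib, if_pos hC, h3]
    rw [sum_const, card_univ, nsmul_one]
    linarith
  · have : Subsingleton C := Set.subsingleton_coe _ |>.2 (Set.not_nontrivial_iff.1 hC)
    have hd (x : C) : H.degree x = 0 := by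
      rw [← degree_toSimpleGraph C x]
      exact Nat.eq_zero_of_not_pos fun h =>
        let ⟨y, hy⟩ := (SimpleGraph.degree_pos_iff_exists_adj _ _).1 h
        hy.ne (Subsingleton.elim _ _)
    simp [hd, hC]

theorem sum_degree_sub_one {H : SimpleGraph V} [DecidableRel H.Adj] {c : ℕ}
    (hc : ∀ C ∈ nontrivialComponents H, IsCyclicOfRank c C.toSimpleGraph) :
    ∑ x, ((H.degree x - 1 : ℕ) : ℝ) =
      (∑ x, (H.degree x : ℝ)) / 2 + (nontrivialComponents H).ncard * ((c : ℝ) - 1) := by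
  classical
  have e (f : V → ℝ) : ∑ x, f x = ∑ C : H.ConnectedComponent, ∑ x : C, f x :=
    (Fintype.sum_fiberwise H.connectedComponentMk f).symm
  rw [e, e, sum_congr rfl fun C _ => sum_degree_sub_one_component hc C, sum_add_distrib, sum_div,
    ← sum_filter, sum_const, nsmul_eq_mul, Set.ncard_eq_toFinset_card']
  congr 4
  ext; simp

theorem laplacianSum_le_clique_add {G : SimpleGraph V} [DecidableRel G.Adj] {K : Finset V}
    (hK : G.IsClique K) {c : ℕ}
    (hc : ∀ C ∈ nontrivialComponents (removeEdgesWithin G K), IsCyclicOfRank c C.toSimpleGraph)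
    (k : ℕ) :
    laplacianSum G k ≤ min (#K * (k : ℝ)) (#K * (#K - 1)) +
      (#G.edgeFinset - #K * (#K - 1) / 2 + 2 * k +
        (nontrivialComponents (removeEdgesWithin G K)).ncard * ((c : ℝ) - 1)) := by
  classical
  obtain ⟨S, hS, h⟩ := exists_laplacianSum_eq G k
  have hS' : (#S : ℝ) ≤ k := by exact_mod_cast hS
  set b := (G.isHermitian_lapMatrix ℝ).eigenvectorBasis
  have h1 := sum_lapMatrix_form_le (removeEdgesWithin G K) b S
  have h2 := (sum_clique_form_le_card_mul K S b).trans
    (mul_le_mul_of_nonneg_left hS' (Nat.cast_nonneg _))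
  have h3 := le_min h2 (sum_clique_form_le_trace K S b)
  have h4 := sum_degree_eq_add G hK
  have h5 : ∑ x, (G.degree x : ℝ) = 2 * #G.edgeFinset := by
    exact_mod_cast G.sum_degrees_eq_twice_card_edges
  rw [sum_degree_sub_one hc] at h1
  rw [h, sum_congr rfl fun i _ => lapMatrix_form_eq_add G hK (b i), sum_add_distrib]
  linarith

end Brouwer

theorem mainTheorem5 {V : Type*} [Fintype V] [DecidableEq V]
    (G : SimpleGraph V) [DecidableRel G.Adj] (n m ω r c : ℕ)
    (hn : Fintype.card V = n) (hn4 : 4 ≤ n) (hm : G.edgeFinset.card = m)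
    (hG : G.Connected)
    (hω : G.cliqueNum = ω) (hω2 : 2 ≤ ω)
    (K : Finset V) (hK : G.IsNClique ω K)
    (hr : (Brouwer.nontrivialComponents (Brouwer.removeEdgesWithin G K)).ncard = r)
    (hc : ∀ C ∈ Brouwer.nontrivialComponents (Brouwer.removeEdgesWithin G K),
      Brouwer.IsCyclicOfRank c C.toSimpleGraph) :
    (∀ k : ℕ, 1 ≤ k →
      (k : ℝ) ≤ min ((ω : ℝ) - 2)
        ((2 * (ω : ℝ) + 3 - Real.sqrt (16 * (ω : ℝ) + 8 * (r : ℝ) * ((c : ℝ) - 1) + 9)) / 2) →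
      Brouwer.laplacianSum G k ≤ (m : ℝ) + (k : ℝ) * ((k : ℝ) + 1) / 2) ∧
    (∀ k : ℕ,
      (3 + Real.sqrt (4 * (ω : ℝ) ^ 2 - 4 * (ω : ℝ) + 8 * (r : ℝ) * ((c : ℝ) - 1) + 9)) / 2
        ≤ (k : ℝ) →
      k ≤ n →
      Brouwer.laplacianSum G k ≤ (m : ℝ) + (k : ℝ) * ((k : ℝ) + 1) / 2) := by
  have hKc : Finset.card K = ω := hK.card_eq
  have key (k : ℕ) := Brouwer.laplacianSum_le_clique_add hK.isClique hc k
  rw [hr, hm, hKc] at key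
  constructor
  · intro k _ hk
    have h1 := (key k).trans (add_le_add_left (min_le_left _ _) _)
    have h2 := hk.trans (min_le_right _ _)
    have h3 := (Real.sqrt_le_left (y := 2 * (ω : ℝ) + 3 - 2 * k)
      (by linarith [hk.trans (min_le_left _ _), (Nat.cast_nonneg ω : (0 : ℝ) ≤ ω)])).1
        (by linarith)
    linarith
  · intro k hk _
    have h1 := (key k).trans (add_le_add_left (min_le_right _ _) _)
    have h3 := (Real.sqrt_le_iff.1 (show _ ≤ 2 * (k : ℝ) - 3 by linarith)).2
    linarith
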